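/- Let all sets and families below be finite. For families $\mathcal F,\mathcal B$ of sets and a set $B$, write $\mathcal F(B)=\{F\setminus B : F\in\mathcal F,\ B\subseteq F\}$ and $\mathcal F[\mathcal B]=\{F\in\mathcal F : B\subseteq F\text{ for some }B\in\mathcal B\}$; let $\partial_h\mathcal F$ be the family of all $h$-element subsets of members of $\mathcal F$, and $\partial_{\le h}\mathcal F=\bigcup_{h'\le h}\partial_{h'}\mathcal F$. A family $\mathcal F$ is $r$-spread if $|\mathcal F(X)|\le r^{-|X|}|\mathcal F|$ for every set $X$, and a family $\mathcal A$ is $(r,t)$-spread if $\mathcal A(T)$ is $r$-spread for every $T\in\partial_{\le t}\mathcal A$. A sunflower with $s$ petals is a family of $s$ distinct sets $F_1,\dots,F_s$ such that $F_i\cap F_j=\bigcap_{u=1}^s F_u$ for all $i\ne j$; the set $\bigcap_{u=1}^s F_u$ is its core. **Lemma.** Let $s\ge 2$, $t\ge 2$, $k$ and $q\le k$ be integers with $k,q\ge 0$, let $\varepsilon\in(0,1)$ and let $r$ be a real number with $\varepsilon r>2^{17}sq$. Let $\mathcal A$ be a $k$-uniform $(r,t)$-spread family (every member of $\mathcal A$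 has exactly $k$ elements), and put $A_t=\max_{T\in\partial_t\mathcal A}|\mathcal A(T)|$ (with $A_t=0$ if $\partial_t\mathcal A=\varnothing$). Suppose that a family $\mathcal S\subseteq\partial_{\le q}\mathcal A$ consists of sets of cardinality at least $t$ and does not contain a sunflower with $s$ petals and core of size at most $t-1$. Then there exists a family $\mathcal T\subseteq\partial_t\mathcal A$ that does not contain any sunflower with $s$ petals and satisfies $$|\mathcal A[\mathcal S]\setminus\mathcal A[\mathcal T]|\ \le\ \bigl|\mathcal A\bigl[\mathcal S\setminus\mathcal S[\mathcal T]\bigr]\bigr|\ \le\ (2^{14}s\log_2 t)^t\cdot\frac{\varepsilon}{1-\varepsilon}\cdot A_t .$$ -/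

import Mathlib

namespace SunflowerSimplification

variable {α : Type*} [DecidableEq α]

/-- The link `F(B) = {F \ B : F ∈ 𝓕, B ⊆ F}`. -/
def link (𝓕 : Finset (Finset α)) (B : Finset α) : Finset (Finset α) :=
  (𝓕.filter fun F => B ⊆ F).image fun F => F \ B

/-- The restriction `𝓕[𝓑]`: the members of `𝓕` that contain some member of `𝓑`. -/
def restrict (𝓕 𝓑 : Finset (Finset α)) : Finset (Finset α) :=
  𝓕.filter fun F => ∃ B ∈ 𝓑, B ⊆ F

/-- The shadow `∂_h 𝓕` of `𝓕` on the layer `h`: all `h`-element subsets of members of `𝓕`. -/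
def shadow (h : ℕ) (𝓕 : Finset (Finset α)) : Finset (Finset α) :=
  𝓕.biUnion fun F => F.powersetCard h

/-- `∂_{≤ h} 𝓕`, the union of the shadows of `𝓕` on the layers `0, …, h`. -/
def shadowLE (h : ℕ) (𝓕 : Finset (Finset α)) : Finset (Finset α) :=
  (Finset.range (h + 1)).biUnion fun h' => shadow h' 𝓕

/-- A family is `R`-spread if `|𝓕(X)| ≤ R^{-|X|} |𝓕|` for every set `X`. -/
def IsSpread (R : ℝ) (𝓕 : Finset (Finset α)) : Prop :=
  ∀ X : Finset α, ((link 𝓕 X).card : ℝ) ≤ (R ^ X.card)⁻¹ * (𝓕.card : ℝ)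

/-- `(r, t)`-spreadness: all links of sets in `∂_{≤ t} 𝓐` are `r`-spread. -/
def IsSpreadDomain (r : ℝ) (t : ℕ) (𝓐 : Finset (Finset α)) : Prop :=
  ∀ T ∈ shadowLE t 𝓐, IsSpread r (link 𝓐 T)

/-- `P` is a sunflower with `s` petals and core `C`: it consists of exactly `s` (distinct) sets,
`C` is the intersection of all of them, and any two distinct ones meet exactly in `C`. -/
def IsSunflower (s : ℕ) (P : Finset (Finset α)) (C : Finset α) : Prop :=
  P.card = s ∧ (∀ x, x ∈ C ↔ ∀ F ∈ P, x ∈ F) ∧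
    ∀ F ∈ P, ∀ G ∈ P, F ≠ G → F ∩ G = C

/-- `A_t = max_{T ∈ ∂_t 𝓐} |𝓐(T)|` (equal to `0` if `∂_t 𝓐` is empty). -/
def maxLink (𝓐 : Finset (Finset α)) (t : ℕ) : ℕ :=
  (shadow t 𝓐).sup fun T => (link 𝓐 T).card

end SunflowerSimplification

/-! Call a family a simplification of `𝓢` if it consists of subsets of members of `𝓢`, of size at
least `t`, each member of `𝓢` contains one of them, and it has no `s`-petal sunflower with core
smaller than `t`. Take a simplification `𝓑` with fewest sets and let `𝓣` be its layer of size `t`.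
Distinct `t`-sets meet in fewer than `t` points, so `𝓣` has no sunflower at all.

A member of `𝓐` counted in the error contains some `B ∈ 𝓑` with `t < |B| ≤ q`. Spreadness of `𝓐`
bounds the degree of `B` by `r ^ (-(|B| - t)) * A_t`, so it suffices that layer `i` of `𝓑` has at
most `φ ^ t * K ^ (i - t)` sets, where `φ = 2 ^ 14 * s * log₂ t` and `K = 2 ^ 17 * s * q < ε * r`; a
geometric series then finishes.

Minimality makes the links of `𝓑` small above level `t` (`IsSimplification.replace`,
`exists_isSimplification`). If a layer were too large, a largest set `X` of fewer than `t` points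
with excessive degree would have a spread link, hence be the core of a sunflower
(`card_le_of_degree_le`).

That spread lemma (`exists_coloring_of_spread`) colours points at random and shrinks fragments by a
recolouring encoding. As links above level `t` are tiny, one colour brings fragments down to size
`t`, and halving from there costs about `log₂ t` colours rather than `log₂ q`. -/

namespace SunflowerSimplification

/-! ### Random colourings and shrinking fragments. -/

section Fragments

set_option linter.unusedSectionVars false

variable {V κ ι : Type*} [Fintype V] [DecidableEq V] [Fintype κ] [DecidableEq κ] [DecidableEq ι]

/-- The number of indices in `G` whose set contains `T`. -/
def codeg (A : ι → Finset V) (G : Finset ι) (T : Finset V) : ℕ :=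
  (G.filter fun F => T ⊆ A F).card

/-- Colour all points of `T` with `a`. -/
def recolor (c : V → κ) (T : Finset V) (a : κ) : V → κ := fun x => if x ∈ T then a else c x

/-- Recolouring forgets only the values on `T`, so these values recover the original colouring. -/
lemma card_recolor_fiber_le (T : Finset V) (a : κ) (c' : V → κ) :
    (Finset.univ.filter fun c : V → κ => recolor c T a = c').card ≤ Fintype.card κ ^ T.card := by
  have h : (Finset.univ.filter fun c : V → κ => recolor c T a = c').card ≤
      (Finset.univ : Finset (T → κ)).card := by
    refine Finset.card_le_card_of_injOn (fun c x => c x) (fun _ _ => Finset.mem_univ _) ?_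
    intro c hc d hd hcd
    have hc' : recolor c T a = c' := by simpa using hc
    have hd' : recolor d T a = c' := by simpa using hd
    funext x
    by_cases hx : x ∈ T
    · exact congrFun hcd ⟨x, hx⟩
    · have := congrFun (hc'.trans hd'.symm) x
      simpa [recolor, hx] using this
  simpa using h

/-- For every colouring `c`, a system of indices `idx c ⊆ G` and of fragments `frag c F ⊆ A F` of
size at most `l`, determined by the classes of the colours in `used` and avoiding these classes,
such that every fragment together with these classes contains a member of the family. On average
over `c`, at most a proportion `b` of `G` is missing from `idx c`. -/
structure IsFragmentSystem (A : ι → Finset V) (G : Finset ι) (used : Finset κ) (l : ℕ) (b : ℝ)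
    (idx : (V → κ) → Finset ι) (frag : (V → κ) → ι → Finset V) : Prop where
  congr : ∀ c c' : V → κ, (∀ x, ∀ a ∈ used, c x = a ↔ c' x = a) →
    idx c = idx c' ∧ frag c = frag c'
  idx_subset : ∀ c, idx c ⊆ G
  frag_subset : ∀ c, ∀ F ∈ idx c, frag c F ⊆ A F
  card_frag : ∀ c, ∀ F ∈ idx c, (frag c F).card ≤ l
  avoid : ∀ c, ∀ F ∈ idx c, ∀ x ∈ frag c F, c x ∉ used
  complete : ∀ c, ∀ F ∈ idx c, ∃ F' ∈ G, ∀ x ∈ A F', x ∈ frag c F ∨ c x ∈ used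
  sum_le : ∑ c : V → κ, ((G \ idx c).card : ℝ) ≤ b * G.card * (Fintype.card κ : ℝ) ^ Fintype.card V

def HasFragmentSystem (A : ι → Finset V) (G : Finset ι) (used : Finset κ) (l : ℕ) (b : ℝ) : Prop :=
  ∃ idx frag, IsFragmentSystem A G used l b idx frag

/-- The index `F` has a fragment of size at most `l` modulo `W`. -/
def Refinable (I : Finset ι) (h : ι → Finset V) (W : Finset V) (l : ℕ) (F : ι) : Prop :=
  ∃ F' ∈ I, h F' \ W ⊆ h F ∧ (h F' \ W).card ≤ l

open Classical in
/-- The indices that have a fragment of size at most `l` modulo `W`. -/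
noncomputable def refineIdx (I : Finset ι) (h : ι → Finset V) (W : Finset V) (l : ℕ) : Finset ι :=
  I.filter (Refinable I h W l)

open Classical in
/-- A choice of a fragment of size at most `l` modulo `W`. -/
noncomputable def refineFrag (I : Finset ι) (h : ι → Finset V) (W : Finset V) (l : ℕ) (F : ι) :
    Finset V :=
  if hF : Refinable I h W l F then h hF.choose \ W else ∅

lemma refineFrag_spec {I : Finset ι} {h : ι → Finset V} {W : Finset V} {l : ℕ} {F : ι}
    (hF : F ∈ refineIdx I h W l) :
    ∃ F' ∈ I, refineFrag I h W l F = h F' \ W ∧ h F' \ W ⊆ h F ∧ (h F' \ W).card ≤ l := by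
  classical
  have hF' : Refinable I h W l F := (Finset.mem_filter.1 hF).2
  refine ⟨hF'.choose, hF'.choose_spec.1, ?_, hF'.choose_spec.2⟩
  simp [refineFrag, hF']

lemma HasFragmentSystem.mono {A : ι → Finset V} {G : Finset ι} {used : Finset κ} {l : ℕ} {b b' : ℝ}
    (h : HasFragmentSystem A G used l b) (hb : b ≤ b') : HasFragmentSystem A G used l b' := by
  obtain ⟨I, f, h⟩ := h
  exact ⟨I, f, { h with sum_le := h.sum_le.trans (by gcongr) }⟩

lemma hasFragmentSystem_empty {A : ι → Finset V} {G : Finset ι} {l : ℕ}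
    (hl : ∀ F ∈ G, (A F).card ≤ l) : HasFragmentSystem A G (∅ : Finset κ) l 0 :=
  ⟨fun _ => G, fun _ => A, by
    constructor
    · simp
    · simp
    · simp
    · intro _; exact hl
    · simp
    · intro _ F hF; exact ⟨F, hF, fun x hx => Or.inl hx⟩
    · simp⟩

/-- The pairs of a colouring and an index without a small fragment are encoded by the recoloured
colouring and the minimal fragment. -/
lemma exists_fragment_of_not_refinable {A : ι → Finset V} {G : Finset ι} {used : Finset κ} {l l' : ℕ}
    {b : ℝ} {idx : (V → κ) → Finset ι} {frag : (V → κ) → ι → Finset V}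
    (h : IsFragmentSystem A G used l b idx frag) {a : κ} (ha : a ∉ used) :
    ∃ H : (V → κ) → Finset V, (∀ c, (H c).card ≤ l) ∧
      ∀ c, ∀ F ∈ idx c, ¬ Refinable (idx c) (frag c) (Finset.univ.filter fun x => c x = a) l' F →
        ∃ T, T ⊆ H (recolor c T a) ∧ l' < T.card ∧ T ⊆ A F := by
  classical
  let P : (V → κ) → ι → Prop := fun c F =>
    F ∈ idx c ∧ frag c F ⊆ Finset.univ.filter fun x => c x = a
  -- `H c'` is a canonical fragment inside class `a` of `c'`; it depends on `c'` alone. The default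
  -- `∅` is never reached at the recolouring of a bad pair.
  refine ⟨fun c => if hc : ∃ F, P c F then frag c hc.choose else ∅, ?_, ?_⟩
  · intro c
    dsimp only
    split_ifs with hc
    · exact h.card_frag c _ hc.choose_spec.1
    · simp
  · intro c F hF hbad
    set W := Finset.univ.filter fun x => c x = a with hW
    -- Among the remainders modulo `W` inside the fragment of `F`, take a smallest one; it will be
    -- `T`.
    obtain ⟨F₀, hF₀, hmin⟩ := Finset.exists_min_image
      ((idx c).filter fun F' => frag c F' \ W ⊆ frag c F) (fun F' => (frag c F' \ W).card)
      ⟨F, Finset.mem_filter.2 ⟨hF, Finset.sdiff_subset⟩⟩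
    obtain ⟨hF₀I, hF₀s⟩ := Finset.mem_filter.1 hF₀
    set T := frag c F₀ \ W with hT
    refine ⟨T, ?_, ?_, hF₀s.trans (h.frag_subset c F hF)⟩
    · have hTused : ∀ x ∈ T, c x ∉ used := fun x hx => h.avoid c F hF x (hF₀s hx)
      -- `T` avoids the used colours and `a` is unused, so recolouring changes no used class and
      -- leaves the system intact.
      obtain ⟨h1, h2⟩ := h.congr c (recolor c T a) (by
        intro x a' ha'
        by_cases hx : x ∈ T
        · have h3 : c x ≠ a' := fun e => hTused x hx (e ▸ ha')
          have h4 : a ≠ a' := fun e => ha (e ▸ ha')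
          simp [recolor, hx, h3, h4]
        · simp [recolor, hx])
      have hex : ∃ F', P (recolor c T a) F' := by
        refine ⟨F₀, h1 ▸ hF₀I, ?_⟩
        rw [← h2]
        intro x hx
        by_cases hxW : x ∈ W
        · have : c x = a := (Finset.mem_filter.1 hxW).2
          simp [recolor, this]
        · have : x ∈ T := Finset.mem_sdiff.2 ⟨hx, hxW⟩
          simp [recolor, this]
      dsimp only
      rw [dif_pos hex]
      obtain ⟨h5, h6⟩ := hex.choose_spec
      set F₁ := hex.choose
      rw [← h1] at h5
      rw [← h2] at h6 ⊢
      have h7 : frag c F₁ \ W ⊆ T := by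
        intro x hx
        obtain ⟨hx1, hx2⟩ := Finset.mem_sdiff.1 hx
        by_contra hxT
        have := (Finset.mem_filter.1 (h6 hx1)).2
        simp only [recolor, hxT, if_false] at this
        exact hx2 (Finset.mem_filter.2 ⟨Finset.mem_univ _, this⟩)
      -- The canonical fragment leaves a remainder inside `T`; by minimality this remainder is `T`,
      -- so `T ⊆ H (recolor c T a)`.
      have h8 := hmin F₁ (Finset.mem_filter.2 ⟨h5, h7.trans hF₀s⟩)
      rw [← Finset.eq_of_subset_of_card_le h7 h8]
      exact Finset.sdiff_subset
    · by_contra hle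
      exact hbad ⟨F₀, hF₀I, hF₀s, not_lt.1 hle⟩

/-- Double counting of bad pairs `(c, F)`: fix the recoloured `c'`, then `T` among the subsets of
the small set `H c'`. At most `|κ| ^ |T|` colourings `c` recolour to `c'`, and `codeg A G T` indices
`F` contain `T`. -/
lemma sum_card_not_refinable_le {A : ι → Finset V} {G : Finset ι} {used : Finset κ} {l l' : ℕ}
    {b β : ℝ} {idx : (V → κ) → Finset ι} {frag : (V → κ) → ι → Finset V}
    (h : IsFragmentSystem A G used l b idx frag) {a : κ} (ha : a ∉ used)
    (hβ : ∀ H : Finset V, H.card ≤ l → ∑ T ∈ H.powerset with l' < T.card,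
      (Fintype.card κ : ℝ) ^ T.card * (codeg A G T : ℝ) ≤ β * G.card) :
    ∑ c : V → κ, ((idx c \ refineIdx (idx c) (frag c) (Finset.univ.filter fun x => c x = a) l').card
      : ℝ) ≤ β * G.card * (Fintype.card κ : ℝ) ^ Fintype.card V := by
  classical
  obtain ⟨H, hHl, hH⟩ := exists_fragment_of_not_refinable (l' := l') h ha
  let Bad : (V → κ) → Finset ι := fun c =>
    idx c \ refineIdx (idx c) (frag c) (Finset.univ.filter fun x => c x = a) l'
  have hsub : (Finset.univ.biUnion fun c => ({c} : Finset (V → κ)) ×ˢ Bad c) ⊆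
      Finset.univ.biUnion fun c' => ((H c').powerset.filter fun T => l' < T.card).biUnion fun T =>
        (Finset.univ.filter fun c : V → κ => recolor c T a = c') ×ˢ
          (G.filter fun F => T ⊆ A F) := by
    rintro ⟨c, F⟩ hcF
    simp only [Finset.mem_biUnion, Finset.mem_univ, true_and, Finset.mem_product,
      Finset.mem_singleton, exists_eq_left'] at hcF
    obtain ⟨hF1, hF2⟩ := Finset.mem_sdiff.1 hcF
    obtain ⟨T, hT1, hT2, hT3⟩ := hH c F hF1 (fun hr => hF2 (Finset.mem_filter.2 ⟨hF1, hr⟩))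
    simp only [Finset.mem_biUnion, Finset.mem_univ, true_and, Finset.mem_product,
      Finset.mem_filter, Finset.mem_powerset]
    exact ⟨_, T, ⟨hT1, hT2⟩, rfl, h.idx_subset c hF1, hT3⟩
  have hcard : (Finset.univ.biUnion fun c => ({c} : Finset (V → κ)) ×ˢ Bad c).card =
      ∑ c, (Bad c).card := by
    rw [Finset.card_biUnion]
    · simp
    · intro c _ d _ hcd
      rw [Function.onFun, Finset.disjoint_left]
      rintro ⟨e, F⟩ h1 h2
      simp only [Finset.mem_product, Finset.mem_singleton] at h1 h2
      exact hcd (h1.1.symm.trans h2.1)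
  have hmain : ∑ c, (Bad c).card ≤ ∑ c' : V → κ, ∑ T ∈ (H c').powerset with l' < T.card,
      Fintype.card κ ^ T.card * codeg A G T := by
    rw [← hcard]
    refine (Finset.card_le_card hsub).trans (Finset.card_biUnion_le.trans ?_)
    refine Finset.sum_le_sum fun c' _ => Finset.card_biUnion_le.trans ?_
    refine Finset.sum_le_sum fun T _ => ?_
    rw [Finset.card_product]
    exact Nat.mul_le_mul_right _ (card_recolor_fiber_le T a c')
  calc ∑ c : V → κ, ((Bad c).card : ℝ)
      ≤ ∑ c' : V → κ, ∑ T ∈ (H c').powerset with l' < T.card,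
        (Fintype.card κ : ℝ) ^ T.card * (codeg A G T : ℝ) := by exact_mod_cast hmain
    _ ≤ ∑ _c' : V → κ, β * G.card := Finset.sum_le_sum fun c' _ => hβ _ (hHl c')
    _ = β * G.card * (Fintype.card κ : ℝ) ^ Fintype.card V := by
        simp [Finset.sum_const, mul_comm]

/-- Spending one fresh colour `a`: fragments lose the points of colour `a`, and the indices newly
lost are those counted by the encoding. -/
lemma HasFragmentSystem.refine {A : ι → Finset V} {G : Finset ι} {used : Finset κ} {l l' : ℕ}
    {b β : ℝ} (h : HasFragmentSystem A G used l b) {a : κ} (ha : a ∉ used)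
    (hβ : ∀ H : Finset V, H.card ≤ l → ∑ T ∈ H.powerset with l' < T.card,
      (Fintype.card κ : ℝ) ^ T.card * (codeg A G T : ℝ) ≤ β * G.card) :
    HasFragmentSystem A G (insert a used) l' (b + β) := by
  classical
  obtain ⟨idx, frag, h⟩ := h
  have hbad := sum_card_not_refinable_le h ha hβ
  let W : (V → κ) → Finset V := fun c => Finset.univ.filter fun x => c x = a
  refine ⟨fun c => refineIdx (idx c) (frag c) (W c) l',
    fun c => refineFrag (idx c) (frag c) (W c) l', ?_⟩
  have hsubset : ∀ c, refineIdx (idx c) (frag c) (W c) l' ⊆ idx c :=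
    fun c => Finset.filter_subset _ _
  constructor
  · intro c c' hcc
    obtain ⟨h1, h2⟩ := h.congr c c' fun x a' ha' => hcc x a' (Finset.mem_insert_of_mem ha')
    have h3 : W c = W c' :=
      Finset.filter_congr fun x _ => hcc x a (Finset.mem_insert_self _ _)
    simp only [h1, h2, h3, and_self]
  · exact fun c => (hsubset c).trans (h.idx_subset c)
  · intro c F hF
    obtain ⟨F', hF', he, hs, -⟩ := refineFrag_spec hF
    rw [he]
    exact hs.trans (h.frag_subset c F (hsubset c hF))
  · intro c F hF
    obtain ⟨F', hF', he, -, hs⟩ := refineFrag_spec hF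
    rwa [he]
  · intro c F hF x hx
    obtain ⟨F', hF', he, -, -⟩ := refineFrag_spec hF
    rw [he] at hx
    obtain ⟨hx1, hx2⟩ := Finset.mem_sdiff.1 hx
    rw [Finset.mem_insert, not_or]
    exact ⟨fun e => hx2 (Finset.mem_filter.2 ⟨Finset.mem_univ _, e⟩), h.avoid c F' hF' x hx1⟩
  · intro c F hF
    obtain ⟨F', hF', he, -, -⟩ := refineFrag_spec hF
    obtain ⟨F₁, hF₁, hcov⟩ := h.complete c F' hF'
    refine ⟨F₁, hF₁, fun x hx => ?_⟩
    rw [he, Finset.mem_sdiff, Finset.mem_insert]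
    rcases hcov x hx with h1 | h1
    · by_cases hxa : c x = a
      · exact Or.inr (Or.inl hxa)
      · exact Or.inl ⟨h1, fun e => hxa (Finset.mem_filter.1 e).2⟩
    · exact Or.inr (Or.inr h1)
  · have hsplit : ∀ c, ((G \ refineIdx (idx c) (frag c) (W c) l').card : ℝ) ≤
        ((G \ idx c).card : ℝ) + ((idx c \ refineIdx (idx c) (frag c) (W c) l').card : ℝ) := by
      intro c
      have : G \ refineIdx (idx c) (frag c) (W c) l' ⊆
          (G \ idx c) ∪ (idx c \ refineIdx (idx c) (frag c) (W c) l') := by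
        intro F hF
        simp only [Finset.mem_union, Finset.mem_sdiff] at hF ⊢
        tauto
      exact_mod_cast (Finset.card_le_card this).trans (Finset.card_union_le _ _)
    calc _ ≤ ∑ c, (((G \ idx c).card : ℝ) +
          ((idx c \ refineIdx (idx c) (frag c) (W c) l').card : ℝ)) :=
        Finset.sum_le_sum fun c _ => hsplit c
      _ ≤ _ := by
        rw [Finset.sum_add_distrib, add_mul, add_mul]
        exact add_le_add h.sum_le hbad

lemma sum_powerset_le {A : ι → Finset V} {G : Finset ι} {N : ℝ} {l l' n : ℕ} (H : Finset V)
    (hH : H.card ≤ l)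
    (hd : ∀ T : Finset V, l' < T.card → N ^ T.card * (codeg A G T : ℝ) ≤ (1 / 2) ^ n * G.card) :
    ∑ T ∈ H.powerset with l' < T.card, N ^ T.card * (codeg A G T : ℝ) ≤
      2 ^ l * (1 / 2) ^ n * G.card := by
  calc _ ≤ ∑ T ∈ H.powerset with l' < T.card, ((1 / 2 : ℝ) ^ n * G.card) :=
        Finset.sum_le_sum fun T hT => hd T (Finset.mem_filter.1 hT).2
    _ = ((H.powerset.filter fun T => l' < T.card).card : ℝ) * ((1 / 2 : ℝ) ^ n * G.card) := by
        rw [Finset.sum_const, nsmul_eq_mul]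
    _ ≤ 2 ^ l * ((1 / 2 : ℝ) ^ n * G.card) := by
        gcongr
        have h1 : (H.powerset.filter fun T => l' < T.card).card ≤ 2 ^ H.card :=
          (Finset.card_filter_le _ _).trans (Finset.card_powerset H).le
        have h2 : (H.powerset.filter fun T => l' < T.card).card ≤ 2 ^ l :=
          h1.trans (Nat.pow_le_pow_right (by norm_num) hH)
        exact_mod_cast h2
    _ = _ := by ring

/-- The encoding sums over at most `2 ^ l` sets `T`, each of size at least `l / 2 + 1`; the saving
`2 ^ (-11 * |T|)` outweighs their number. Old and new losses are each at most half of the new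
allowance. -/
lemma HasFragmentSystem.halve {A : ι → Finset V} {G : Finset ι} {used : Finset κ} {l : ℕ}
    (h : HasFragmentSystem A G used l ((1 / 2) ^ (l + 2))) {a : κ} (ha : a ∉ used)
    (hd : ∀ T : Finset V, 0 < T.card →
      (Fintype.card κ : ℝ) ^ T.card * (codeg A G T : ℝ) ≤ (1 / 2) ^ (11 * T.card) * G.card) :
    HasFragmentSystem A G (insert a used) (l / 2) ((1 / 2) ^ (l / 2 + 2)) := by
  have hhalf : ∀ {m n : ℕ}, m ≤ n → (1 / 2 : ℝ) ^ n ≤ (1 / 2) ^ m := fun hmn =>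
    pow_le_pow_of_le_one (by norm_num) (by norm_num) hmn
  rcases Nat.eq_zero_or_pos l with rfl | hl
  -- At `l = 0` there is no nonempty `T` to sum over, so the colour costs nothing.
  · have := h.refine (l' := 0) (β := 0) ha (by
      intro H hH
      have : H = ∅ := Finset.card_eq_zero.1 (Nat.le_zero.1 hH)
      subst this
      simp [Finset.sum_filter])
    simpa using this
  · refine (h.refine (l' := l / 2) (β := 2 ^ l * (1 / 2) ^ (11 * (l / 2 + 1))) ha ?_).mono ?_
    · intro H hH
      refine sum_powerset_le H hH fun T hT => (hd T (by omega)).trans ?_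
      gcongr ?_ * _
      exact hhalf (by omega)
    · have h1 : (1 / 2 : ℝ) ^ (l + 2) ≤ (1 / 2) ^ (l / 2 + 3) := hhalf (by omega)
      have h2 : (2 : ℝ) ^ l * (1 / 2) ^ (11 * (l / 2 + 1)) ≤ (1 / 2) ^ (l / 2 + 3) := by
        calc (2 : ℝ) ^ l * (1 / 2) ^ (11 * (l / 2 + 1))
            ≤ 2 ^ l * (1 / 2) ^ (l + (l / 2 + 3)) := by
              gcongr 2 ^ l * ?_
              exact hhalf (by omega)
          _ = (2 * (1 / 2)) ^ l * (1 / 2) ^ (l / 2 + 3) := by rw [pow_add, mul_pow]; ring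
          _ = _ := by norm_num
      calc _ ≤ (1 / 2 : ℝ) ^ (l / 2 + 3) + (1 / 2) ^ (l / 2 + 3) := add_le_add h1 h2
        _ = _ := by ring

lemma HasFragmentSystem.iterate_halve {A : ι → Finset V} {G : Finset ι}
    (hd : ∀ T : Finset V, 0 < T.card →
      (Fintype.card κ : ℝ) ^ T.card * (codeg A G T : ℝ) ≤ (1 / 2) ^ (11 * T.card) * G.card)
    {used : Finset κ} {l : ℕ} (h : HasFragmentSystem A G used l ((1 / 2) ^ (l + 2)))
    (C : Finset κ) (hC : Disjoint C used) :
    HasFragmentSystem A G (C ∪ used) (l / 2 ^ C.card) ((1 / 2) ^ (l / 2 ^ C.card + 2)) := by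
  induction C using Finset.induction_on with
  | empty => simpa using h
  | insert a C haC ih =>
    rw [Finset.disjoint_insert_left] at hC
    have := (ih hC.2).halve (a := a) (by simp [haC, hC.1]) hd
    rwa [Nat.div_div_eq_div_mul, ← pow_succ, ← Finset.card_insert_of_notMem haC,
      ← Finset.insert_union] at this

/-- Few colourings have no member of the family inside the classes of the colours in `used`. -/
lemma HasFragmentSystem.card_fail_le {A : ι → Finset V} {G : Finset ι} {used : Finset κ} {b : ℝ}
    (h : HasFragmentSystem A G used 0 b) (hG : G.Nonempty) (Fail : Finset (V → κ))
    (hF : ∀ c ∈ Fail, ¬ ∃ F ∈ G, ∀ x ∈ A F, c x ∈ used) :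
    (Fail.card : ℝ) ≤ b * (Fintype.card κ : ℝ) ^ Fintype.card V := by
  obtain ⟨idx, frag, h⟩ := h
  have hidx : ∀ c ∈ Fail, idx c = ∅ := by
    intro c hc
    by_contra hne
    obtain ⟨F, hFi⟩ := Finset.nonempty_iff_ne_empty.2 hne
    obtain ⟨F', hF', hcov⟩ := h.complete c F hFi
    have h0 : frag c F = ∅ := Finset.card_eq_zero.1 (Nat.le_zero.1 (h.card_frag c F hFi))
    exact hF c hc ⟨F', hF', fun x hx => by simpa [h0] using hcov x hx⟩
  have h1 : (Fail.card : ℝ) * G.card ≤ b * G.card * (Fintype.card κ : ℝ) ^ Fintype.card V := by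
    refine le_trans ?_ h.sum_le
    calc (Fail.card : ℝ) * G.card = ∑ c ∈ Fail, ((G \ idx c).card : ℝ) := by
          rw [Finset.sum_congr rfl fun c hc => by rw [hidx c hc, Finset.sdiff_empty]]
          simp
      _ ≤ _ := Finset.sum_le_sum_of_subset_of_nonneg (Finset.subset_univ _)
          fun _ _ _ => Nat.cast_nonneg _
  have hG' : (0 : ℝ) < G.card := by exact_mod_cast hG.card_pos
  have h2 : (Fail.card : ℝ) * G.card ≤ b * (Fintype.card κ : ℝ) ^ Fintype.card V * G.card := by
    linarith
  exact le_of_mul_le_mul_right h2 hG'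

end Fragments

/-! ### The spread lemma: many colour classes containing members. -/

/-- A family of sets of size at most `m` which is spread, and very spread on sets of more than `t`
elements, has members in at least `s` of the `2 * s` classes of some colouring. -/
theorem exists_coloring_of_spread {V ι : Type*} [Fintype V] [DecidableEq V] [DecidableEq ι]
    {A : ι → Finset V} {G : Finset ι} {s t m J : ℕ} (hs : 0 < s) (hJ : t < 2 ^ J) (htm : t < m)
    (hG : G.Nonempty) (hm : ∀ F ∈ G, (A F).card ≤ m)
    (hd : ∀ T : Finset V, 0 < T.card → ((2 * s * (J + 1) : ℕ) : ℝ) ^ T.card * (codeg A G T : ℝ) ≤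
      (1 / 2) ^ (11 * T.card) * G.card)
    (hd' : ∀ T : Finset V, t < T.card → ((2 * s * (J + 1) : ℕ) : ℝ) ^ T.card * (codeg A G T : ℝ) ≤
      (1 / 2) ^ (11 * m) * G.card) :
    ∃ (c : V → Fin (2 * s)) (Q : Finset (Fin (2 * s))), Q.card = s ∧
      ∀ a ∈ Q, ∃ F ∈ G, ∀ x ∈ A F, c x = a := by
  classical
  -- Each of the `2 * s` final colours is split into `J + 1` shades: one to pass from size `m` to
  -- `t`, and `J` to halve from `t` down to `0`.
  let κ := Fin (2 * s) × Fin (J + 1)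
  have hκ : Fintype.card κ = 2 * s * (J + 1) := by simp [κ]
  rw [← hκ] at hd hd'
  have hsys : ∀ a : Fin (2 * s),
      HasFragmentSystem A G (({a} : Finset (Fin (2 * s))) ×ˢ (Finset.univ : Finset (Fin (J + 1)))) 0
        ((1 / 2) ^ 2) := by
    intro a
    have h1 : HasFragmentSystem A G (insert (a, (0 : Fin (J + 1))) (∅ : Finset κ)) t
        ((1 / 2) ^ (t + 2)) := by
      refine ((hasFragmentSystem_empty (κ := κ) hm).refine (l' := t) (a := (a, 0)) (by simp)
        (β := 2 ^ m * (1 / 2) ^ (11 * m)) fun H hH => sum_powerset_le H hH hd').mono ?_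
      calc 0 + (2 : ℝ) ^ m * (1 / 2) ^ (11 * m) ≤ 2 ^ m * (1 / 2) ^ (m + (t + 2)) := by
            rw [zero_add]
            gcongr 2 ^ m * ?_
            exact pow_le_pow_of_le_one (by norm_num) (by norm_num) (by omega)
        _ = (2 * (1 / 2)) ^ m * (1 / 2) ^ (t + 2) := by rw [pow_add, mul_pow]; ring
        _ = _ := by norm_num
    have h2 := h1.iterate_halve hd
      (({a} : Finset (Fin (2 * s))) ×ˢ (Finset.univ.erase (0 : Fin (J + 1)))) (by
        simp)
    have hc : (({a} : Finset (Fin (2 * s))) ×ˢ (Finset.univ.erase (0 : Fin (J + 1)))).card = J := by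
      simp
    rw [hc, Nat.div_eq_of_lt hJ, zero_add] at h2
    convert h2 using 1
    ext ⟨x, y⟩
    simp only [Finset.mem_product, Finset.mem_singleton, Finset.mem_univ, and_true,
      Finset.mem_union, Finset.mem_erase, Finset.mem_insert, Finset.notMem_empty, or_false,
      Prod.mk.injEq]
    tauto
  let Good : (V → κ) → Fin (2 * s) → Prop := fun c a => ∃ F ∈ G, ∀ x ∈ A F, (c x).1 = a
  have hfail : ∀ a, ((Finset.univ.filter fun c : V → κ => ¬ Good c a).card : ℝ) ≤
      (1 / 2) ^ 2 * (Fintype.card κ : ℝ) ^ Fintype.card V := by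
    intro a
    refine (hsys a).card_fail_le hG _ ?_
    rintro c hc ⟨F, hF, hFc⟩
    exact (Finset.mem_filter.1 hc).2 ⟨F, hF, fun x hx =>
      Finset.mem_singleton.1 (Finset.mem_product.1 (hFc x hx)).1⟩
  obtain ⟨c, hc⟩ : ∃ c : V → κ, s ≤ (Finset.univ.filter fun a => Good c a).card := by
    by_contra hcon
    push Not at hcon
    have hpos : (0 : ℝ) < (Fintype.card κ : ℝ) ^ Fintype.card V := by
      have : 0 < Fintype.card κ := by rw [hκ]; positivity
      positivity
    -- Averaging: each final colour fails for at most a quarter of the colourings, so on average at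
    -- most `s / 2` colours fail, whereas here at least `s` would always fail.
    have h1 : ∀ c : V → κ, (s : ℝ) ≤ ((Finset.univ.filter fun a => ¬ Good c a).card : ℝ) := by
      intro c
      have h2 := Finset.card_filter_add_card_filter_not (s := (Finset.univ : Finset (Fin (2 * s))))
        (fun a => Good c a)
      have h3 := hcon c
      rw [Finset.card_univ, Fintype.card_fin] at h2
      exact_mod_cast (by omega : s ≤ (Finset.univ.filter fun a => ¬ Good c a).card)
    have h2 : ∑ c : V → κ, ((Finset.univ.filter fun a => ¬ Good c a).card : ℝ) =
        ∑ a, ((Finset.univ.filter fun c : V → κ => ¬ Good c a).card : ℝ) := by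
      simp only [Finset.card_filter, Nat.cast_sum]
      exact Finset.sum_comm
    have h3 : ∑ _c : V → κ, (s : ℝ) ≤ ∑ _a : Fin (2 * s),
        (1 / 2 : ℝ) ^ 2 * (Fintype.card κ : ℝ) ^ Fintype.card V :=
      (Finset.sum_le_sum fun c _ => h1 c).trans
        (h2.le.trans (Finset.sum_le_sum fun a _ => hfail a))
    simp only [Finset.sum_const, Finset.card_univ, Fintype.card_fun, Fintype.card_fin,
      nsmul_eq_mul, Nat.cast_pow, Nat.cast_mul, Nat.cast_ofNat] at h3
    have hs' : (0 : ℝ) < s := by exact_mod_cast hs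
    nlinarith [mul_pos hpos hs']
  obtain ⟨Q, hQ, hQs⟩ := Finset.exists_subset_card_eq hc
  exact ⟨fun x => (c x).1, Q, hQs, fun a ha => (Finset.mem_filter.1 (hQ ha)).2⟩

/-! ### Sunflowers from spread links, and the size of a layer. -/

section Layers

variable {α : Type*} [DecidableEq α]

/-- The number of members of `𝓦` that contain `X`. -/
def degree (𝓦 : Finset (Finset α)) (X : Finset α) : ℕ := (𝓦.filter fun F => X ⊆ F).card

lemma isSunflower_of_inter_eq {s : ℕ} {P : Finset (Finset α)} {C : Finset α} (hs : 2 ≤ s)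
    (hP : P.card = s) (h : ∀ F ∈ P, ∀ G ∈ P, F ≠ G → F ∩ G = C) : IsSunflower s P C := by
  refine ⟨hP, fun x => ⟨fun hx F hF => ?_, fun hx => ?_⟩, h⟩
  · obtain ⟨G, hG, hGF⟩ := Finset.exists_mem_ne (by omega : 1 < P.card) F
    rw [← h F hF G hG hGF.symm] at hx
    exact (Finset.mem_inter.1 hx).1
  · obtain ⟨F, hF, G, hG, hFG⟩ := Finset.one_lt_card.1 (by omega : 1 < P.card)
    rw [← h F hF G hG hFG]
    exact Finset.mem_inter.2 ⟨hx F hF, hx G hG⟩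

/-- Sets whose parts outside `X` carry different single colours meet exactly in `X`. Since no member
equals `X`, these parts are nonempty and the petals are distinct. -/
lemma exists_isSunflower_of_coloring {κ : Type*} {s : ℕ} {𝓦 : Finset (Finset α)}
    {X : Finset α} {c : α → κ} {Q : Finset κ} (hs : 2 ≤ s) (hQ : Q.card = s)
    (hX : ∀ F ∈ 𝓦, F ≠ X)
    (h : ∀ a ∈ Q, ∃ F ∈ 𝓦, X ⊆ F ∧ ∀ x ∈ F \ X, c x = a) :
    ∃ P ⊆ 𝓦, IsSunflower s P X := by
  classical
  choose! f hf𝓦 hfX hfc using h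
  have hinter : ∀ a ∈ Q, ∀ b ∈ Q, a ≠ b → f a ∩ f b = X := by
    intro a ha b hb hab
    refine Finset.Subset.antisymm (fun x hx => ?_) (Finset.subset_inter (hfX a ha) (hfX b hb))
    obtain ⟨h1, h2⟩ := Finset.mem_inter.1 hx
    by_contra hxX
    exact hab ((hfc a ha x (Finset.mem_sdiff.2 ⟨h1, hxX⟩)).symm.trans
      (hfc b hb x (Finset.mem_sdiff.2 ⟨h2, hxX⟩)))
  have hinj : Set.InjOn f Q := by
    intro a ha b hb hab
    by_contra hne
    have := hinter a ha b hb hne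
    rw [← hab, Finset.inter_self] at this
    exact hX _ (hf𝓦 a ha) this
  refine ⟨Q.image f, Finset.image_subset_iff.2 hf𝓦, isSunflower_of_inter_eq hs ?_ ?_⟩
  · rw [Finset.card_image_of_injOn hinj, hQ]
  · intro F hF G hG hFG
    obtain ⟨a, ha, rfl⟩ := Finset.mem_image.1 hF
    obtain ⟨b, hb, rfl⟩ := Finset.mem_image.1 hG
    exact hinter a ha b hb fun hab => hFG (hab ▸ rfl)

/-- The spread lemma for families whose members are large but whose links are very small beyond
level `t`. -/
lemma exists_isSunflower_of_degree_le {s t i J : ℕ} {𝓦 : Finset (Finset α)} {X : Finset α}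
    (hs : 2 ≤ s) (hJ : t - X.card < 2 ^ J) (hXt : X.card ≤ t) (hti : t < i)
    (h𝓦 : ∀ F ∈ 𝓦, F.card = i) (hpos : 0 < degree 𝓦 X)
    (hd : ∀ Y : Finset α, X ⊂ Y → ((2 * s * (J + 1) : ℕ) : ℝ) ^ (Y.card - X.card) *
      (degree 𝓦 Y : ℝ) ≤ (1 / 2) ^ (11 * (Y.card - X.card)) * degree 𝓦 X)
    (hd' : ∀ Y : Finset α, X ⊂ Y → t < Y.card → ((2 * s * (J + 1) : ℕ) : ℝ) ^ (Y.card - X.card) *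
      (degree 𝓦 Y : ℝ) ≤ (1 / 2) ^ (11 * (i - X.card)) * degree 𝓦 X) :
    ∃ P ⊆ 𝓦, IsSunflower s P X := by
  classical
  -- The colouring argument needs a finite ground type, so it is run on the union of the family.
  let V : Finset α := 𝓦.biUnion id
  let A : Finset α → Finset V := fun F => (F \ X).subtype (· ∈ V)
  let G := 𝓦.filter fun F => X ⊆ F
  have hcodeg : ∀ T : Finset V, 0 < T.card → codeg A G T = 0 ∨
      (X ⊂ X ∪ T.map (Function.Embedding.subtype _) ∧
        (X ∪ T.map (Function.Embedding.subtype _)).card - X.card = T.card ∧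
        codeg A G T ≤ degree 𝓦 (X ∪ T.map (Function.Embedding.subtype _))) := by
    intro T hT
    rcases Nat.eq_zero_or_pos (codeg A G T) with h0 | h0
    · exact Or.inl h0
    right
    have hmap : ∀ F, T ⊆ A F → T.map (Function.Embedding.subtype _) ⊆ F \ X := by
      intro F hF x hx
      obtain ⟨y, hy, rfl⟩ := Finset.mem_map.1 hx
      exact Finset.mem_subtype.1 (hF hy)
    obtain ⟨F, hF⟩ := Finset.card_pos.1 h0
    have hdisj : Disjoint X (T.map (Function.Embedding.subtype _)) :=
      (Finset.disjoint_sdiff).mono_right (hmap F (Finset.mem_filter.1 hF).2)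
    have hcard := Finset.card_union_of_disjoint hdisj
    rw [Finset.card_map] at hcard
    refine ⟨(Finset.ssubset_iff_subset_ne).2 ⟨Finset.subset_union_left, fun e => ?_⟩, by omega, ?_⟩
    · rw [← e] at hcard; omega
    · refine Finset.card_le_card fun F hF => ?_
      obtain ⟨h1, h2⟩ := Finset.mem_filter.1 hF
      obtain ⟨h3, h4⟩ := Finset.mem_filter.1 h1
      exact Finset.mem_filter.2 ⟨h3, Finset.union_subset h4 ((hmap F h2).trans
        Finset.sdiff_subset)⟩
  have hmem : ∀ F ∈ G, ∀ x (hx : x ∈ F \ X), ∃ hV : x ∈ V, (⟨x, hV⟩ : V) ∈ A F := by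
    intro F hF x hx
    have hV : x ∈ V := Finset.mem_biUnion.2
      ⟨F, (Finset.mem_filter.1 hF).1, (Finset.mem_sdiff.1 hx).1⟩
    exact ⟨hV, Finset.mem_subtype.2 hx⟩
  obtain ⟨c, Q, hQ, hc⟩ := exists_coloring_of_spread (A := A) (G := G) (s := s) (t := t - X.card)
    (m := i - X.card) (J := J) (by omega) hJ (by omega) (Finset.card_pos.1 hpos) (by
      intro F hF
      obtain ⟨h1, h2⟩ := Finset.mem_filter.1 hF
      rw [← h𝓦 F h1, ← Finset.card_sdiff_of_subset h2]
      have := Finset.card_subtype (· ∈ V) (F \ X)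
      exact this.le.trans (Finset.card_filter_le _ _)) (by
      intro T hT
      rcases hcodeg T hT with h0 | ⟨h1, h2, h3⟩
      · rw [h0]; simp
      · have h4 := hd _ h1
        rw [h2] at h4
        refine le_trans ?_ h4
        gcongr) (by
      intro T hT
      rcases hcodeg T (by omega) with h0 | ⟨h1, h2, h3⟩
      · rw [h0]; simp
      · have h4 := hd' _ h1 (by omega)
        rw [h2] at h4
        refine le_trans ?_ h4
        gcongr)
  have hQ0 : Q.Nonempty := Finset.card_pos.1 (by omega)
  -- An arbitrary colour for points outside `V`, which lie in no member.
  obtain ⟨a₀, -⟩ := hQ0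
  refine exists_isSunflower_of_coloring (c := fun x => if hx : x ∈ V then c ⟨x, hx⟩ else a₀) hs hQ
    (fun F hF e => by have := h𝓦 F hF; rw [e] at this; omega) fun a ha => ?_
  obtain ⟨F, hF, hFc⟩ := hc a ha
  refine ⟨F, (Finset.mem_filter.1 hF).1, (Finset.mem_filter.1 hF).2, fun x hx => ?_⟩
  obtain ⟨hV, hxA⟩ := hmem F hF x hx
  simpa [hV] using hFc _ hxA

/-- The number of shades is `2 * s * (J + 1)` with `J = Nat.log 2 t + 1`, and `2 ^ 11` pays for the
factor `(1 / 2) ^ 11` per element in the spread lemma. -/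
lemma petal_constants {s t q : ℕ} (ht : 2 ≤ t) (htq : t ≤ q) :
    2 ^ 11 * ((2 * s * (Nat.log 2 t + 1 + 1) : ℕ) : ℝ) ≤ 2 ^ 14 * (s : ℝ) * Real.logb 2 t ∧
    2 ^ 11 * ((2 * s * (Nat.log 2 t + 1 + 1) : ℕ) : ℝ) ≤ 2 ^ 17 * (s : ℝ) * q := by
  have h1 : (1 : ℝ) ≤ Real.logb 2 t := by
    rw [Real.le_logb_iff_rpow_le (by norm_num) (by positivity)]
    simpa using (by exact_mod_cast ht : (2 : ℝ) ≤ t)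
  have h2 : (Nat.log 2 t : ℝ) ≤ Real.logb 2 t := by
    exact_mod_cast Real.natLog_le_logb t 2
  have h3 : (Nat.log 2 t : ℝ) ≤ q := by
    exact_mod_cast ((Nat.log_lt_self 2 (by omega)).le.trans htq)
  have h4 : (1 : ℝ) ≤ q := by exact_mod_cast (by omega : 1 ≤ q)
  have hs : (0 : ℝ) ≤ s := Nat.cast_nonneg s
  push_cast
  constructor
  · calc _ = 2 ^ 12 * (s : ℝ) * (Nat.log 2 t + 2) := by ring
      _ ≤ 2 ^ 12 * (s : ℝ) * (4 * Real.logb 2 t) := by gcongr; linarith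
      _ = _ := by ring
  · calc _ = 2 ^ 12 * (s : ℝ) * (Nat.log 2 t + 2) := by ring
      _ ≤ 2 ^ 12 * (s : ℝ) * (32 * q) := by gcongr; linarith
      _ = _ := by ring

/-- A uniform family without sunflowers with small core and with small links beyond level `t`. -/
lemma card_le_of_degree_le {s t i q : ℕ} (hs : 2 ≤ s) (ht : 2 ≤ t) (hti : t < i) (hiq : i ≤ q)
    {𝓦 : Finset (Finset α)} (h𝓦 : ∀ F ∈ 𝓦, F.card = i)
    (hdeg : ∀ X : Finset α, t ≤ X.card → degree 𝓦 X ≤ (s * q) ^ (i - X.card))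
    (hsun : ¬ ∃ P ⊆ 𝓦, ∃ C : Finset α, IsSunflower s P C ∧ C.card ≤ t - 1) :
    (𝓦.card : ℝ) ≤ (2 ^ 14 * (s : ℝ) * Real.logb 2 t) ^ t * (2 ^ 17 * (s : ℝ) * q) ^ (i - t) := by
  obtain ⟨hNφ, hNK⟩ := petal_constants (s := s) ht (by omega : t ≤ q)
  set N : ℝ := ((2 * s * (Nat.log 2 t + 1 + 1) : ℕ) : ℝ) with hN
  set φ : ℝ := 2 ^ 14 * (s : ℝ) * Real.logb 2 t with hφ
  set K : ℝ := 2 ^ 17 * (s : ℝ) * q with hK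
  have hN0 : 0 < N := by
    rw [hN]; exact_mod_cast (by positivity : 0 < 2 * s * (Nat.log 2 t + 1 + 1))
  have hφ0 : 0 < φ := lt_of_lt_of_le (by positivity) hNφ
  have hK0 : 0 < K := lt_of_lt_of_le (by positivity) hNK
  have hRK : 2 ^ 11 * ((s * q : ℕ) : ℝ) ≤ K := by
    push_cast
    have : (0 : ℝ) ≤ (s : ℝ) * q := by positivity
    linarith
  by_contra! hlarge
  let Large : Finset α → Prop := fun X =>
    X.card < t ∧ φ ^ (t - X.card) * K ^ (i - t) < degree 𝓦 X
  -- The empty set is large because the layer itself exceeds the bound; choose a large set of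
  -- maximal size.
  obtain ⟨n, ⟨X, hX, rfl⟩, hmax⟩ : ∃ n, (∃ X, Large X ∧ X.card = n) ∧
      ∀ Y, Large Y → Y.card ≤ n := by
    have hbdd : BddAbove {n | ∃ X, Large X ∧ X.card = n} :=
      ⟨t, by rintro _ ⟨X, hX, rfl⟩; exact hX.1.le⟩
    have hne : {n | ∃ X, Large X ∧ X.card = n}.Nonempty :=
      ⟨0, ∅, ⟨by simp; omega, by simpa [degree] using hlarge⟩, rfl⟩
    exact ⟨_, Nat.sSup_mem hne hbdd, fun Y hY => le_csSup hbdd ⟨Y, hY, rfl⟩⟩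
  obtain ⟨hXt, hXdeg⟩ := hX
  have hpos : 0 < degree 𝓦 X := by
    have : (0 : ℝ) < degree 𝓦 X := lt_trans (by positivity) hXdeg
    exact_mod_cast this
  have hupper : ∀ Y : Finset α, X ⊂ Y → t ≤ Y.card →
      N ^ (Y.card - X.card) * (degree 𝓦 Y : ℝ) ≤ (1 / 2) ^ (11 * (i - X.card)) * degree 𝓦 X := by
    intro Y hXY hYt
    -- Unless the degree vanishes, `Y` lies in a member, so `i - Y.card` is not truncated.
    rcases Nat.eq_zero_or_pos (degree 𝓦 Y) with h0 | h0
    · rw [h0]; simp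
    obtain ⟨F, hF⟩ := Finset.card_pos.1 h0
    obtain ⟨hF1, hF2⟩ := Finset.mem_filter.1 hF
    have hYi : Y.card ≤ i := h𝓦 F hF1 ▸ Finset.card_le_card hF2
    have hYd : (degree 𝓦 Y : ℝ) ≤ ((s * q : ℕ) : ℝ) ^ (i - Y.card) := by
      exact_mod_cast hdeg Y hYt
    have key : (2 : ℝ) ^ (11 * (i - X.card)) * (N ^ (Y.card - X.card) * (degree 𝓦 Y : ℝ)) ≤
        degree 𝓦 X := by
      calc (2 : ℝ) ^ (11 * (i - X.card)) * (N ^ (Y.card - X.card) * (degree 𝓦 Y : ℝ))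
          ≤ (2 : ℝ) ^ (11 * (i - X.card)) *
            (N ^ (Y.card - X.card) * ((s * q : ℕ) : ℝ) ^ (i - Y.card)) := by gcongr
        _ = (2 ^ 11 * N) ^ (t - X.card) * ((2 ^ 11 * N) ^ (Y.card - t) *
            (2 ^ 11 * ((s * q : ℕ) : ℝ)) ^ (i - Y.card)) := by
            -- The points from `|X|` up to `t` are charged to `φ`; those from `t` to `|Y|` and from
            -- `|Y|` to `i` are charged to `K`.
            have e1 : i - X.card = (t - X.card) + (Y.card - t) + (i - Y.card) := by omega
            have e2 : Y.card - X.card = (t - X.card) + (Y.card - t) := by omega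
            rw [pow_mul, e1, e2, mul_pow, mul_pow, mul_pow]
            simp only [pow_add]
            ring
        _ ≤ φ ^ (t - X.card) * (K ^ (Y.card - t) * K ^ (i - Y.card)) := by gcongr
        _ = φ ^ (t - X.card) * K ^ (i - t) := by
            rw [← pow_add]; congr 3; omega
        _ ≤ degree 𝓦 X := hXdeg.le
    rw [one_div, inv_pow, inv_mul_eq_div, le_div_iff₀ (by positivity)]
    linarith
  refine hsun ?_
  obtain ⟨P, hP, hPs⟩ := exists_isSunflower_of_degree_le (J := Nat.log 2 t + 1) hs
    (lt_of_le_of_lt (Nat.sub_le _ _) (Nat.lt_pow_succ_log_self (by norm_num) t)) hXt.le hti h𝓦 hpos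
    (by
      intro Y hXY
      have hcard := Finset.card_lt_card hXY
      rcases lt_or_ge Y.card t with hYt | hYt
      · have hYd : (degree 𝓦 Y : ℝ) ≤ φ ^ (t - Y.card) * K ^ (i - t) := by
          by_contra! hcon
          exact absurd (hmax Y ⟨hYt, hcon⟩) (by omega)
        have key : (2 : ℝ) ^ (11 * (Y.card - X.card)) *
            (N ^ (Y.card - X.card) * (degree 𝓦 Y : ℝ)) ≤ degree 𝓦 X := by
          calc _ = (2 ^ 11 * N) ^ (Y.card - X.card) * (degree 𝓦 Y : ℝ) := by
                rw [pow_mul, mul_pow]; ring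
            _ ≤ φ ^ (Y.card - X.card) * (φ ^ (t - Y.card) * K ^ (i - t)) := by gcongr
            _ = φ ^ (t - X.card) * K ^ (i - t) := by
                rw [← mul_assoc, ← pow_add]; congr 2; omega
            _ ≤ degree 𝓦 X := hXdeg.le
        rw [one_div, inv_pow, inv_mul_eq_div, le_div_iff₀ (by positivity)]
        linarith
      · rcases Nat.eq_zero_or_pos (degree 𝓦 Y) with h0 | h0
        · rw [h0]; simp
        obtain ⟨F, hF⟩ := Finset.card_pos.1 h0
        obtain ⟨hF1, hF2⟩ := Finset.mem_filter.1 hF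
        have hYi : Y.card ≤ i := h𝓦 F hF1 ▸ Finset.card_le_card hF2
        refine (hupper Y hXY hYt).trans ?_
        gcongr ?_ * _
        exact pow_le_pow_of_le_one (by norm_num) (by norm_num) (by omega))
    (fun Y hXY hYt => hupper Y hXY hYt.le)
  exact ⟨P, hP, X, hPs, by omega⟩

end Layers

/-! ### Minimal simplifications. -/

section Simplification

variable {α : Type*} [DecidableEq α]

/-- A family of subsets of members of `𝓢` of size at least `t` that covers `𝓢` and has no sunflower
with `s` petals and core of size less than `t`. -/
structure IsSimplification (s t : ℕ) (𝓢 𝓑 : Finset (Finset α)) : Prop where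
  cover : ∀ S ∈ 𝓢, ∃ B ∈ 𝓑, B ⊆ S
  le_card : ∀ B ∈ 𝓑, t ≤ B.card
  exists_superset : ∀ B ∈ 𝓑, ∃ S ∈ 𝓢, B ⊆ S
  not_sunflower : ¬ ∃ P ⊆ 𝓑, ∃ C : Finset α, IsSunflower s P C ∧ C.card ≤ t - 1

/-- A set `X` with a spread link in some layer may replace all sets that contain it. -/
lemma IsSimplification.replace {s t q i : ℕ} {𝓢 𝓑 : Finset (Finset α)} {X : Finset α}
    (hs : 2 ≤ s) (hq : ∀ S ∈ 𝓢, S.card ≤ q) (h : IsSimplification s t 𝓢 𝓑)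
    (hX : t ≤ X.card)
    (hlarge : (s * q) ^ (i - X.card) < degree (𝓑.filter fun B => B.card = i) X)
    (hmax : ∀ x ∉ X, degree (𝓑.filter fun B => B.card = i) (insert x X) ≤
      (s * q) ^ (i - (X.card + 1))) :
    IsSimplification s t 𝓢 (insert X (𝓑.filter fun B => ¬ X ⊆ B)) := by
  have h𝓑q : ∀ B ∈ 𝓑, B.card ≤ q := fun B hB => by
    obtain ⟨S, hS, hBS⟩ := h.exists_superset B hB
    exact (Finset.card_le_card hBS).trans (hq S hS)
  set 𝓦 := 𝓑.filter fun B => B.card = i with h𝓦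
  obtain ⟨B₀, hB₀⟩ : ∃ B, B ∈ 𝓦.filter fun B => X ⊆ B :=
    Finset.card_pos.1 (lt_of_le_of_lt (Nat.zero_le _) hlarge)
  obtain ⟨hB₀𝓦, hXB₀⟩ := Finset.mem_filter.1 hB₀
  obtain ⟨hB₀𝓑, hB₀i⟩ := Finset.mem_filter.1 hB₀𝓦
  -- If `|X| = i`, only `X` itself can be counted, while the degree exceeds `(s * q) ^ 0 = 1`.
  have hXi : X.card < i := by
    refine lt_of_le_of_ne (hB₀i ▸ Finset.card_le_card hXB₀) fun e => ?_
    have h1 : (𝓦.filter fun B => X ⊆ B).card ≤ 1 := by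
      refine Finset.card_le_one.2 fun B hB C hC => ?_
      obtain ⟨hB1, hB2⟩ := Finset.mem_filter.1 hB
      obtain ⟨hC1, hC2⟩ := Finset.mem_filter.1 hC
      have hBi := (Finset.mem_filter.1 hB1).2
      have hCi := (Finset.mem_filter.1 hC1).2
      rw [← Finset.eq_of_subset_of_card_le hB2 (by omega),
        ← Finset.eq_of_subset_of_card_le hC2 (by omega)]
    rw [e, Nat.sub_self, pow_zero] at hlarge
    exact absurd h1 (not_le.2 hlarge)
  have hiq : i ≤ q := hB₀i ▸ h𝓑q B₀ hB₀𝓑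
  refine ⟨fun S hS => ?_, fun B hB => ?_, fun B hB => ?_, ?_⟩
  · obtain ⟨B, hB, hBS⟩ := h.cover S hS
    by_cases hXB : X ⊆ B
    · exact ⟨X, Finset.mem_insert_self _ _, hXB.trans hBS⟩
    · exact ⟨B, Finset.mem_insert_of_mem (Finset.mem_filter.2 ⟨hB, hXB⟩), hBS⟩
  · rcases Finset.mem_insert.1 hB with rfl | hB
    · exact hX
    · exact h.le_card B (Finset.mem_filter.1 hB).1
  · rcases Finset.mem_insert.1 hB with rfl | hB
    · obtain ⟨S, hS, hBS⟩ := h.exists_superset B₀ hB₀𝓑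
      exact ⟨S, hS, hXB₀.trans hBS⟩
    · exact h.exists_superset B (Finset.mem_filter.1 hB).1
  · rintro ⟨P, hP, C, ⟨hPs, -, hPC⟩, hC⟩
    by_cases hXP : X ∈ P
    swap
    · exact h.not_sunflower ⟨P, fun F hF => by
        rcases Finset.mem_insert.1 (hP hF) with rfl | hF'
        · exact absurd hF hXP
        · exact (Finset.mem_filter.1 hF').1, C, isSunflower_of_inter_eq hs hPs hPC, hC⟩
    have hP' : ∀ F ∈ P.erase X, F ∈ 𝓑 ∧ ¬ X ⊆ F := by
      intro F hF
      obtain ⟨h1, h2⟩ := Finset.mem_erase.1 hF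
      exact Finset.mem_filter.1 ((Finset.mem_insert.1 (hP h2)).resolve_left h1)
    -- A sunflower using the new petal `X` is pulled back to `𝓑`: replace `X` by some `B ⊇ X` in
    -- layer `i` that misses the rest `U` of the other petals, keeping the core.
    set U := (P.erase X).biUnion id \ X with hU
    have hUcard : U.card ≤ (s - 1) * q := by
      refine (Finset.card_le_card Finset.sdiff_subset).trans ?_
      have := Finset.card_biUnion_le_card_mul (P.erase X) id q fun F hF => h𝓑q F (hP' F hF).1
      rwa [Finset.card_erase_of_mem hXP, hPs] at this
    obtain ⟨B, hB, hBU⟩ : ∃ B ∈ 𝓦.filter fun B => X ⊆ B, Disjoint B U := by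
      by_contra! hcon
      have hsub : (𝓦.filter fun B => X ⊆ B) ⊆
          U.biUnion fun u => 𝓦.filter fun B => insert u X ⊆ B := by
        intro B hB
        obtain ⟨u, hu1, hu2⟩ := Finset.not_disjoint_iff.1 (hcon B hB)
        obtain ⟨hB1, hB2⟩ := Finset.mem_filter.1 hB
        exact Finset.mem_biUnion.2 ⟨u, hu2, Finset.mem_filter.2
          ⟨hB1, Finset.insert_subset hu1 hB2⟩⟩
      -- Each point of `U` spoils at most `(s * q) ^ (i - |X| - 1)` sets and `|U| ≤ (s - 1) * q`,
      -- fewer in total than the degree of `X`.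
      have h1 : degree 𝓦 X ≤ U.card * (s * q) ^ (i - (X.card + 1)) :=
        (Finset.card_le_card hsub).trans (Finset.card_biUnion_le_card_mul _ _ _
          fun u hu => hmax u (Finset.mem_sdiff.1 hu).2)
      have h2 : U.card * (s * q) ^ (i - (X.card + 1)) ≤ (s * q) ^ (i - X.card) := by
        have e : i - X.card = (i - (X.card + 1)) + 1 := by omega
        rw [e, pow_succ, mul_comm]
        exact Nat.mul_le_mul_left _ (hUcard.trans (Nat.mul_le_mul_right _ (Nat.sub_le _ _)))
      omega
    obtain ⟨hB𝓦, hXB⟩ := Finset.mem_filter.1 hB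
    have hBF : ∀ F ∈ P.erase X, B ∩ F = C := by
      intro F hF
      obtain ⟨h1, h2⟩ := Finset.mem_erase.1 hF
      rw [← hPC X hXP F h2 h1.symm]
      refine Finset.Subset.antisymm (fun x hx => ?_) (Finset.inter_subset_inter_right hXB)
      obtain ⟨hx1, hx2⟩ := Finset.mem_inter.1 hx
      refine Finset.mem_inter.2 ⟨?_, hx2⟩
      by_contra hxX
      exact Finset.disjoint_left.1 hBU hx1
        (Finset.mem_sdiff.2 ⟨Finset.mem_biUnion.2 ⟨F, hF, hx2⟩, hxX⟩)
    have hBP : B ∉ P.erase X := fun hBP => (hP' B hBP).2 hXB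
    refine h.not_sunflower ⟨insert B (P.erase X), ?_, C, isSunflower_of_inter_eq hs ?_ ?_, hC⟩
    · exact Finset.insert_subset (Finset.mem_filter.1 hB𝓦).1 fun F hF => (hP' F hF).1
    · rw [Finset.card_insert_of_notMem hBP, Finset.card_erase_of_mem hXP]
      omega
    · intro F hF G hG hFG
      rcases Finset.mem_insert.1 hF with rfl | hF'
      · exact hBF G ((Finset.mem_insert.1 hG).resolve_left (Ne.symm hFG))
      · rcases Finset.mem_insert.1 hG with rfl | hG'
        · rw [Finset.inter_comm]
          exact hBF F hF'
        · exact hPC F (Finset.mem_of_mem_erase hF') G (Finset.mem_of_mem_erase hG') hFG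

/-- A simplification all of whose layers have small links. -/
lemma exists_isSimplification {s t q : ℕ} {𝓢 : Finset (Finset α)} (hs : 2 ≤ s) (ht : 2 ≤ t)
    (hq : ∀ S ∈ 𝓢, S.card ≤ q) (hSt : ∀ S ∈ 𝓢, t ≤ S.card)
    (hSsun : ¬ ∃ P ⊆ 𝓢, ∃ C : Finset α, IsSunflower s P C ∧ C.card ≤ t - 1) :
    ∃ 𝓑, IsSimplification s t 𝓢 𝓑 ∧ ∀ i X, t ≤ X.card →
      degree (𝓑.filter fun B => B.card = i) X ≤ (s * q) ^ (i - X.card) := by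
  classical
  have hex : ∃ n 𝓑, IsSimplification s t 𝓢 𝓑 ∧ 𝓑.card = n :=
    ⟨_, 𝓢, ⟨fun S hS => ⟨S, hS, Finset.Subset.refl _⟩, hSt,
      fun S hS => ⟨S, hS, Finset.Subset.refl _⟩, hSsun⟩, rfl⟩
  obtain ⟨𝓑, h𝓑, hcard⟩ := Nat.find_spec hex
  have hmin : ∀ 𝓑', IsSimplification s t 𝓢 𝓑' → 𝓑.card ≤ 𝓑'.card := fun 𝓑' h' =>
    hcard ▸ Nat.find_min' hex ⟨𝓑', h', rfl⟩
  refine ⟨𝓑, h𝓑, fun i X₀ hX₀ => ?_⟩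
  by_contra! hX₀d
  set 𝓦 := 𝓑.filter fun B => B.card = i with h𝓦
  let Large : Finset α → Prop := fun X => t ≤ X.card ∧ (s * q) ^ (i - X.card) < degree 𝓦 X
  have hLargei : ∀ X, Large X → X.card ≤ i := by
    intro X hX
    obtain ⟨B, hB⟩ := Finset.card_pos.1 (lt_of_le_of_lt (Nat.zero_le _) hX.2)
    obtain ⟨hB1, hB2⟩ := Finset.mem_filter.1 hB
    exact (Finset.mem_filter.1 hB1).2 ▸ Finset.card_le_card hB2
  have hbdd : BddAbove {n | ∃ X, Large X ∧ X.card = n} :=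
    ⟨i, by rintro _ ⟨X, hX, rfl⟩; exact hLargei X hX⟩
  have hne : {n | ∃ X, Large X ∧ X.card = n}.Nonempty := ⟨_, X₀, ⟨hX₀, hX₀d⟩, rfl⟩
  obtain ⟨X, hX, hXn⟩ := Nat.sSup_mem hne hbdd
  -- `X` is a violating set of maximal size, which bounds the degrees of its one-point extensions.
  have hrep := h𝓑.replace hs hq hX.1 hX.2 (by
    intro x hx
    by_contra! hcon
    have h1 : Large (insert x X) := by
      refine ⟨hX.1.trans (Finset.card_le_card (Finset.subset_insert _ _)), ?_⟩
      rwa [Finset.card_insert_of_notMem hx]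
    have h2 := le_csSup hbdd ⟨_, h1, rfl⟩
    rw [← hXn, Finset.card_insert_of_notMem hx] at h2
    omega)
  have h1 := hmin _ hrep
  have h2 := Finset.card_insert_le X (𝓑.filter fun B => ¬ X ⊆ B)
  have h3 := Finset.card_filter_add_card_filter_not (s := 𝓑) (fun B => X ⊆ B)
  have h4 : degree 𝓦 X ≤ (𝓑.filter fun B => X ⊆ B).card :=
    Finset.card_le_card (Finset.filter_subset_filter _ (Finset.filter_subset _ _))
  -- Hence at least two sets contain `X`; replacing them by `X` alone shrinks `𝓑`, against
  -- minimality.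
  have h5 : 1 ≤ (s * q) ^ (i - X.card) := by
    refine Nat.one_le_pow _ _ (Nat.mul_pos (by omega) ?_)
    obtain ⟨B, hB⟩ := Finset.card_pos.1 (lt_of_le_of_lt (Nat.zero_le _) hX.2)
    obtain ⟨S, hS, -⟩ := h𝓑.exists_superset B (Finset.mem_filter.1 (Finset.mem_filter.1 hB).1).1
    have h6 := hq S hS
    have h7 := hSt S hS
    omega
  have h8 := hX.2
  omega

/-! ### Links, shadows and the geometric series. -/

lemma card_link (𝓕 : Finset (Finset α)) (X : Finset α) : (link 𝓕 X).card = degree 𝓕 X := by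
  refine Finset.card_image_of_injOn fun F hF G hG hFG => ?_
  have hF' := (Finset.mem_filter.1 hF).2
  have hG' := (Finset.mem_filter.1 hG).2
  have hFG' : F \ X = G \ X := hFG
  rw [← Finset.sdiff_union_of_subset hF', hFG', Finset.sdiff_union_of_subset hG']

lemma link_link (𝓕 : Finset (Finset α)) {T X : Finset α} (hTX : T ⊆ X) :
    link (link 𝓕 T) (X \ T) = link 𝓕 X := by
  ext F
  simp only [link, Finset.mem_image, Finset.mem_filter]
  constructor
  · rintro ⟨_, ⟨⟨G, ⟨hG, hTG⟩, rfl⟩, hXG⟩, rfl⟩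
    refine ⟨G, ⟨hG, fun x hx => ?_⟩, ?_⟩
    · by_cases hxT : x ∈ T
      · exact hTG hxT
      · exact (Finset.mem_sdiff.1 (hXG (Finset.mem_sdiff.2 ⟨hx, hxT⟩))).1
    · ext x
      simp only [Finset.mem_sdiff]
      have := @hTX x
      tauto
  · rintro ⟨G, ⟨hG, hXG⟩, rfl⟩
    refine ⟨G \ T, ⟨⟨G, ⟨hG, hTX.trans hXG⟩, rfl⟩,
      Finset.sdiff_subset_sdiff hXG (Finset.Subset.refl _)⟩, ?_⟩
    ext x
    simp only [Finset.mem_sdiff]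
    have := @hTX x
    tauto

lemma mem_restrict {𝓕 𝓑 : Finset (Finset α)} {F : Finset α} :
    F ∈ restrict 𝓕 𝓑 ↔ F ∈ 𝓕 ∧ ∃ B ∈ 𝓑, B ⊆ F := Finset.mem_filter

lemma mem_shadow {h : ℕ} {𝓕 : Finset (Finset α)} {T : Finset α} :
    T ∈ shadow h 𝓕 ↔ (∃ F ∈ 𝓕, T ⊆ F) ∧ T.card = h := by
  simp only [shadow, Finset.mem_biUnion, Finset.mem_powersetCard]
  tauto

lemma mem_shadowLE {h : ℕ} {𝓕 : Finset (Finset α)} {T : Finset α} :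
    T ∈ shadowLE h 𝓕 ↔ (∃ F ∈ 𝓕, T ⊆ F) ∧ T.card ≤ h := by
  simp only [shadowLE, Finset.mem_biUnion, mem_shadow, Finset.mem_range, Nat.lt_succ_iff]
  constructor
  · rintro ⟨n, hn, h1, rfl⟩; exact ⟨h1, hn⟩
  · rintro ⟨h1, h2⟩; exact ⟨_, h2, h1, rfl⟩

/-- Pick a `t`-subset `T` of `B`: the link of `B` is the link of `B \ T` in the spread family
`𝓐(T)`, whose size is at most `A_t`. -/
lemma degree_le_maxLink {r : ℝ} {t : ℕ} {𝓐 : Finset (Finset α)} (hA : IsSpreadDomain r t 𝓐)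
    (hr : 0 < r) {B : Finset α} (hB : ∃ F ∈ 𝓐, B ⊆ F) (ht : t ≤ B.card) :
    (degree 𝓐 B : ℝ) ≤ (r ^ (B.card - t))⁻¹ * maxLink 𝓐 t := by
  obtain ⟨T, hTB, hT⟩ := Finset.exists_subset_card_eq ht
  obtain ⟨F, hF, hBF⟩ := hB
  have h1 := hA T (mem_shadowLE.2 ⟨⟨F, hF, hTB.trans hBF⟩, hT.le⟩) (B \ T)
  rw [link_link 𝓐 hTB, card_link, Finset.card_sdiff_of_subset hTB, hT] at h1
  refine h1.trans ?_
  gcongr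
  exact Finset.le_sup (f := fun T => (link 𝓐 T).card)
    (mem_shadow.2 ⟨⟨F, hF, hTB.trans hBF⟩, hT⟩)

lemma sum_Ioc_pow_le {ε : ℝ} (h0 : 0 < ε) (h1 : ε < 1) (t q : ℕ) :
    ∑ i ∈ Finset.Ioc t q, ε ^ (i - t) ≤ ε / (1 - ε) := by
  have hgeom : ∀ n : ℕ, ∑ j ∈ Finset.range n, ε ^ j ≤ (1 - ε)⁻¹ := fun n => by
    rw [← tsum_geometric_of_lt_one h0.le h1]
    exact (summable_geometric_of_lt_one h0.le h1).sum_le_tsum _ fun _ _ => by positivity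
  have hIoc : ∑ i ∈ Finset.Ioc t q, ε ^ (i - t) = ∑ j ∈ Finset.range (q - t), ε * ε ^ j := by
    refine Finset.sum_nbij' (fun i => i - t - 1) (fun j => j + t + 1) ?_ ?_ ?_ ?_ ?_
    · intro i hi; simp only [Finset.mem_Ioc, Finset.mem_range] at *; omega
    · intro j hj; simp only [Finset.mem_Ioc, Finset.mem_range] at *; omega
    · intro i hi; simp only [Finset.mem_Ioc] at *; omega
    · intro j hj; omega
    · intro i hi
      rw [Finset.mem_Ioc] at hi
      rw [← pow_succ']
      congr 1
      omega
  rw [hIoc, ← Finset.mul_sum, div_eq_mul_inv]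
  exact mul_le_mul_of_nonneg_left (hgeom _) h0.le

end Simplification

end SunflowerSimplification

/-! ### Assembly of the simplification lemma. -/

theorem mainTheorem6 {α : Type*} [DecidableEq α] (k t s q : ℕ) (r ε : ℝ)
    (hs : 2 ≤ s) (ht : 2 ≤ t) (hq : q ≤ k) (hε₀ : 0 < ε) (hε₁ : ε < 1)
    (hr : (2 : ℝ) ^ 17 * (s : ℝ) * (q : ℝ) < ε * r)
    (𝓐 𝓢 : Finset (Finset α))
    (hk : (𝓐 : Set (Finset α)).Sized k)
    (hA : SunflowerSimplification.IsSpreadDomain r t 𝓐)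
    (hS : 𝓢 ⊆ SunflowerSimplification.shadowLE q 𝓐)
    (hSsun : ¬ ∃ P ⊆ 𝓢, ∃ C : Finset α,
      SunflowerSimplification.IsSunflower s P C ∧ C.card ≤ t - 1)
    (hSt : ∀ S ∈ 𝓢, t ≤ S.card) :
    ∃ 𝓣 ⊆ SunflowerSimplification.shadow t 𝓐,
      (¬ ∃ P ⊆ 𝓣, ∃ C : Finset α, SunflowerSimplification.IsSunflower s P C) ∧
      (SunflowerSimplification.restrict 𝓐 𝓢 \ SunflowerSimplification.restrict 𝓐 𝓣).card ≤
        (SunflowerSimplification.restrict 𝓐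
          (𝓢 \ SunflowerSimplification.restrict 𝓢 𝓣)).card ∧
      ((SunflowerSimplification.restrict 𝓐
          (𝓢 \ SunflowerSimplification.restrict 𝓢 𝓣)).card : ℝ) ≤
        ((2 : ℝ) ^ 14 * (s : ℝ) * Real.logb 2 (t : ℝ)) ^ t * (ε / (1 - ε)) *
          (SunflowerSimplification.maxLink 𝓐 t : ℝ) := by
  have hSA : ∀ S ∈ 𝓢, (∃ F ∈ 𝓐, S ⊆ F) ∧ S.card ≤ q := fun S hS' =>
    SunflowerSimplification.mem_shadowLE.1 (hS hS')
  obtain ⟨𝓑, h𝓑, hdeg⟩ := SunflowerSimplification.exists_isSimplification hs ht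
    (fun S hS' => (hSA S hS').2) hSt hSsun
  have h𝓑A : ∀ B ∈ 𝓑, (∃ F ∈ 𝓐, B ⊆ F) ∧ B.card ≤ q := by
    intro B hB
    obtain ⟨S, hS', hBS⟩ := h𝓑.exists_superset B hB
    obtain ⟨⟨F, hF, hSF⟩, hSq⟩ := hSA S hS'
    exact ⟨⟨F, hF, hBS.trans hSF⟩, (Finset.card_le_card hBS).trans hSq⟩
  have hr0 : 0 < r := by
    have h1 : 0 < ε * r := lt_of_le_of_lt (by positivity) hr
    exact (mul_pos_iff_of_pos_left hε₀).1 h1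
  have hφ0 : 0 ≤ (2 : ℝ) ^ 14 * (s : ℝ) * Real.logb 2 (t : ℝ) := by
    have : 0 ≤ Real.logb 2 (t : ℝ) :=
      Real.logb_nonneg (by norm_num) (by exact_mod_cast (by omega : 1 ≤ t))
    positivity
  refine ⟨𝓑.filter fun B => B.card = t, ?_, ?_, ?_, ?_⟩
  · intro B hB
    obtain ⟨h1, h2⟩ := Finset.mem_filter.1 hB
    exact SunflowerSimplification.mem_shadow.2 ⟨(h𝓑A B h1).1, h2⟩
  · rintro ⟨P, hP, C, hPC⟩
    refine h𝓑.not_sunflower ⟨P, hP.trans (Finset.filter_subset _ _), C, hPC, ?_⟩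
    obtain ⟨F, hF, G, hG, hFG⟩ := Finset.one_lt_card.1 (by rw [hPC.1]; omega : 1 < P.card)
    have hFt := (Finset.mem_filter.1 (hP hF)).2
    have hGt := (Finset.mem_filter.1 (hP hG)).2
    have hCF : C ⊂ F := by
      rw [← hPC.2.2 F hF G hG hFG]
      refine (Finset.ssubset_iff_subset_ne).2 ⟨Finset.inter_subset_left, fun e => hFG ?_⟩
      exact Finset.eq_of_subset_of_card_le (Finset.inter_eq_left.1 e) (by omega)
    have := Finset.card_lt_card hCF
    omega
  · refine Finset.card_le_card fun F hF => ?_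
    simp only [SunflowerSimplification.mem_restrict, Finset.mem_sdiff, Finset.mem_filter, not_and]
      at hF ⊢
    obtain ⟨⟨hF𝓐, S, hS', hSF⟩, hno⟩ := hF
    refine ⟨hF𝓐, S, ⟨hS', fun _ ⟨B, hB, hBS⟩ => ?_⟩, hSF⟩
    exact hno hF𝓐 ⟨B, hB, hBS.trans hSF⟩
  -- A set `S` outside `𝓢[𝓣]` contains some `B ∈ 𝓑`, and `B` cannot have size `t`; so only the
  -- layers `t < i ≤ q` contribute.
  · have hsub : SunflowerSimplification.restrict 𝓐 (𝓢 \ SunflowerSimplification.restrict 𝓢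
        (𝓑.filter fun B => B.card = t)) ⊆ (Finset.Ioc t q).biUnion fun i =>
          (𝓑.filter fun B => B.card = i).biUnion fun B => 𝓐.filter fun F => B ⊆ F := by
      intro F hF
      simp only [SunflowerSimplification.mem_restrict, Finset.mem_sdiff, Finset.mem_filter, not_and]
        at hF
      obtain ⟨hF𝓐, S, ⟨hS', hno⟩, hSF⟩ := hF
      obtain ⟨B, hB, hBS⟩ := h𝓑.cover S hS'
      simp only [Finset.mem_biUnion, Finset.mem_filter, Finset.mem_Ioc]
      refine ⟨B.card, ⟨lt_of_le_of_ne (h𝓑.le_card B hB) fun e => ?_, (h𝓑A B hB).2⟩, B, ⟨hB, rfl⟩,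
        hF𝓐, hBS.trans hSF⟩
      exact hno hS' ⟨B, ⟨hB, e.symm⟩, hBS⟩
    have hlayer : ∀ i ∈ Finset.Ioc t q,
        ((𝓑.filter fun B => B.card = i).card : ℝ) * ((r ^ (i - t))⁻¹ *
          (SunflowerSimplification.maxLink 𝓐 t : ℝ)) ≤
        ((2 : ℝ) ^ 14 * (s : ℝ) * Real.logb 2 (t : ℝ)) ^ t * ε ^ (i - t) *
          (SunflowerSimplification.maxLink 𝓐 t : ℝ) := by
      intro i hi
      obtain ⟨hti, hiq⟩ := Finset.mem_Ioc.1 hi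
      have h1 := SunflowerSimplification.card_le_of_degree_le hs ht hti hiq
        (𝓦 := 𝓑.filter fun B => B.card = i) (fun F hF => (Finset.mem_filter.1 hF).2)
        (fun X hX => hdeg i X hX) (fun ⟨P, hP, C, hPC⟩ =>
          h𝓑.not_sunflower ⟨P, hP.trans (Finset.filter_subset _ _), C, hPC⟩)
      -- The factor `K ^ (i - t)` from the layer size is absorbed by the spreadness `r ^ (i - t)`,
      -- leaving `ε ^ (i - t)`.
      have h2 : ((2 : ℝ) ^ 17 * s * q) ^ (i - t) ≤ ε ^ (i - t) * r ^ (i - t) := by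
        rw [← mul_pow]
        exact pow_le_pow_left₀ (by positivity) hr.le _
      rw [← mul_assoc]
      refine mul_le_mul_of_nonneg_right ?_ (Nat.cast_nonneg _)
      rw [← div_eq_mul_inv, div_le_iff₀ (by positivity), mul_assoc]
      exact h1.trans (mul_le_mul_of_nonneg_left h2 (by positivity))
    calc _ ≤ ((∑ i ∈ Finset.Ioc t q, ∑ B ∈ 𝓑.filter fun B => B.card = i,
          SunflowerSimplification.degree 𝓐 B : ℕ) : ℝ) := by
          exact_mod_cast (Finset.card_le_card hsub).trans (Finset.card_biUnion_le.trans
            (Finset.sum_le_sum fun i _ => Finset.card_biUnion_le))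
      _ = ∑ i ∈ Finset.Ioc t q, ∑ B ∈ 𝓑.filter fun B => B.card = i,
          (SunflowerSimplification.degree 𝓐 B : ℝ) := by push_cast; rfl
      _ ≤ ∑ i ∈ Finset.Ioc t q, ∑ B ∈ 𝓑.filter fun B => B.card = i,
          ((r ^ (i - t))⁻¹ * (SunflowerSimplification.maxLink 𝓐 t : ℝ)) := by
          refine Finset.sum_le_sum fun i _ => Finset.sum_le_sum fun B hB => ?_
          obtain ⟨h1, rfl⟩ := Finset.mem_filter.1 hB
          exact SunflowerSimplification.degree_le_maxLink hA hr0 (h𝓑A B h1).1 (h𝓑.le_card B h1)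
      _ ≤ ∑ i ∈ Finset.Ioc t q, ((2 : ℝ) ^ 14 * (s : ℝ) * Real.logb 2 (t : ℝ)) ^ t *
          ε ^ (i - t) * (SunflowerSimplification.maxLink 𝓐 t : ℝ) := by
          refine Finset.sum_le_sum fun i hi => ?_
          rw [Finset.sum_const, nsmul_eq_mul]
          exact hlayer i hi
      _ = ((2 : ℝ) ^ 14 * (s : ℝ) * Real.logb 2 (t : ℝ)) ^ t *
          (∑ i ∈ Finset.Ioc t q, ε ^ (i - t)) * (SunflowerSimplification.maxLink 𝓐 t : ℝ) := by
          rw [Finset.mul_sum, Finset.sum_mul]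
      _ ≤ _ := by
          have := SunflowerSimplification.sum_Ioc_pow_le hε₀ hε₁ t q
          gcongr
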